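/- Let $\mathcal R$ and $\mathcal Y$ be finite sets, let $\mathcal X$ be a nonempty measurable space, and let $\Delta_{\mathcal Y}$ be the set of probability distributions on $\mathcal Y$. For a loss $f : R \to \mathbb R_+^{\mathcal Y}$ with report space $R$ and for $p \in \Delta_{\mathcal Y}$ put $\mathrm{prop}[f](p) = \operatorname{argmin}_{r \in R} \langle p, f(r)\rangle$ and $R_f(r,p) = \langle p, f(r)\rangle - \inf_{r' \in R}\langle p, f(r')\rangle$. For a probability distribution $\mathcal D$ on $\mathcal X \times \mathcal Y$ and a measurable $g : \mathcal X \to R$ let $R_f(g;\mathcal D) = \mathbb E_{(X,Y)\sim\mathcal D} f(g(X))_Y - \inf_{g'} \mathbb E_{(X,Y)\sim\mathcal D} f(g'(X))_Y$, the infimum being over all measurable $g' : \mathcal X \to R$. Let $\ell : \mathcal R \to \mathbb R_+^{\mathcal Y}$ be a non-redundant target loss, i.e. for every $r\in\mathcal R$ there is $p \in \Delta_{\mathcal Y}$ with $\mathrm{prop}[\ell](p) = \{r\}$. Let $L : \mathbb R^d \to \mathbb R_+^{\mathcal Y}$ be a polyhedral surrogate loss, i.e. for each $y$ the function $u \mapsto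 L(u)_y$ is a pointwise maximum of finitely many affine functions. Let $\psi : \mathbb R^d \to \mathcal R$ be any map (the link). Write $\gamma = \mathrm{prop}[\ell]$, $\Gamma = \mathrm{prop}[L]$, and $d_\infty(u,A) = \inf_{a \in A}\|u-a\|_\infty$. For $\zeta : \mathbb R_+ \to \mathbb R_+$, say that $(L,\psi)$ *guarantees* $\zeta$ for $\ell$ if $R_\ell(\psi\circ h;\mathcal D) \le \zeta(R_L(h;\mathcal D))$ for all probability distributions $\mathcal D$ on $\mathcal X\times\mathcal Y$ and all $h : \mathcal X \to \mathbb R^d$ such that $h$ and $\psi\circ h$ are measurable and $R_L(h;\mathcal D) < \infty$. The pair $(L,\psi)$ is *consistent* for $\ell$ if it guarantees some $\zeta$ with $\zeta(0)=0$ that is continuous at $0$; it guarantees a *linear regret transfer* if it guarantees $\zeta(t) = \alpha t$ for some $\alpha \ge 0$. The link $\psi$ is *$\epsilon$-separated* with respect to $L$ and $\ell$ if $d_\infty(u,\Gamma(p)) > \epsilon$ for all $p \in \Delta_{\mathcal Y}$ and all $u\in\mathbb R^d$ with $\psi(u)\notin\gamma(p)$. Then the following are equivalent: 1. $(L,\psi)$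 is consistent for $\ell$. 2. $\psi$ is $\epsilon$-separated with respect to $L$ and $\ell$ for some $\epsilon>0$. 3. $(L,\psi)$ guarantees a linear regret transfer for $\ell$. Furthermore, if any of these holds, then $(L,\psi)$ guarantees $$\zeta(t) = \frac{C_\ell H_L}{\epsilon_\psi}\, t$$ for $\ell$, where $C_\ell = \max_{r,r'\in\mathcal R,\, y\in\mathcal Y} (\ell(r)_y - \ell(r')_y)$; $\epsilon_\psi \in (0,\infty]$ is the supremum of all $\epsilon \ge 0$ such that $\psi$ is $\epsilon$-separated with respect to $L$ and $\ell$ (and the quotient is $0$ if $\epsilon_\psi = \infty$); and $H_L = \max_{p \in \mathcal Q} H_{L,p}$, where $H_{L,p}$ is the smallest constant $H \ge 0$ such that $d_\infty(u,\Gamma(p)) \le H\, R_L(u,p)$ for all $u \in \mathbb R^d$, and $\mathcal Q$ is the finite set of all vertices of those level sets $\Gamma_u = \{p \in \Delta_{\mathcal Y} : u \in \Gamma(p)\}$, $u\in\mathbb R^d$, that have the same dimension as $\Delta_{\mathcal Y}$. -/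

import Mathlib

open MeasureTheory
open scoped NNReal ENNReal

namespace SurrogateRegret

noncomputable section

/-! A loss with report space `R` and finite label set `Y` is a map `f : R → Y → ℝ≥0`.
Surrogate losses have report space `Fin d → ℝ`, whose Mathlib norm and distance are the
sup norm `‖·‖_∞` and its distance. -/

/-- The expected loss `⟨p, f(r)⟩`. -/
def expLoss {R Y : Type*} [Fintype Y] (f : R → Y → ℝ≥0) (p : Y → ℝ) (r : R) : ℝ :=
  ∑ y, p y * (f r y : ℝ)

/-- The Bayes risk `inf_r ⟨p, f(r)⟩`. -/
def bayesRisk {R Y : Type*} [Fintype Y] (f : R → Y → ℝ≥0) (p : Y → ℝ) : ℝ :=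
  ⨅ r, expLoss f p r

/-- The conditional regret `R_f(r, p)`. -/
def condRegret {R Y : Type*} [Fintype Y] (f : R → Y → ℝ≥0) (r : R) (p : Y → ℝ) : ℝ :=
  expLoss f p r - bayesRisk f p

/-- The property elicited by `f`: the set of reports minimizing `⟨p, f(·)⟩`. -/
def prop {R Y : Type*} [Fintype Y] (f : R → Y → ℝ≥0) (p : Y → ℝ) : Set R :=
  {r | ∀ r', expLoss f p r ≤ expLoss f p r'}

/-- The level set of the property elicited by `f` at the report `r`: the distributions for
which `r` is optimal. -/
def levelSet {R Y : Type*} [Fintype Y] (f : R → Y → ℝ≥0) (r : R) : Set (Y → ℝ) :=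
  {p | p ∈ stdSimplex ℝ Y ∧ r ∈ prop f p}

/-- Every report is the unique optimal report for some distribution. -/
def NonRedundant {R Y : Type*} [Fintype Y] (f : R → Y → ℝ≥0) : Prop :=
  ∀ r, ∃ p ∈ stdSimplex ℝ Y, prop f p = {r}

/-- A pointwise maximum of a (nonempty) finite set of affine functions. -/
def IsPolyhedral {d : ℕ} (f : (Fin d → ℝ) → ℝ) : Prop :=
  ∃ (s : Finset ((Fin d → ℝ) →ᵃ[ℝ] ℝ)) (hs : s.Nonempty),
    ∀ u, f u = s.sup' hs (fun g => g u)

/-- A surrogate loss is polyhedral if it is so for each fixed label. -/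
def PolyhedralLoss {d : ℕ} {Y : Type*} (L : (Fin d → ℝ) → Y → ℝ≥0) : Prop :=
  ∀ y, IsPolyhedral (fun u => (L u y : ℝ))

/-! ### Risk and regret of hypotheses -/

/-- The risk `E_{(x,y) ∼ D} f(g(x))_y ∈ [0,∞]`. -/
def risk {X R Y : Type*} [MeasurableSpace X] [MeasurableSpace Y] (f : R → Y → ℝ≥0)
    (g : X → R) (D : Measure (X × Y)) : ℝ≥0∞ :=
  ∫⁻ z, (f (g z.1) z.2 : ℝ≥0∞) ∂D

/-- The regret of `g` with respect to all measurable hypotheses, in `[0,∞]`. The infimum is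
at most the risk of a measurable `g`, and it is finite for probability measures `D` and
nonempty `R` and finite `Y` (use a constant hypothesis), so for these the subtraction is
the true one. -/
def regret {X R Y : Type*} [MeasurableSpace X] [MeasurableSpace R] [MeasurableSpace Y]
    (f : R → Y → ℝ≥0) (g : X → R) (D : Measure (X × Y)) : ℝ≥0∞ :=
  risk f g D - ⨅ (g' : X → R) (_ : Measurable g'), risk f g' D

/-- A regret transfer function: it vanishes at `0` and is continuous there. -/
def IsRegretTransfer (ζ : ℝ≥0 → ℝ≥0) : Prop :=
  ζ 0 = 0 ∧ ContinuousAt ζ 0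

/-- The bound `R_ℓ(ψ ∘ h; D) ≤ ζ(R_L(h; D))` for all distributions `D` on `X × Y` and all
hypotheses `h` for which both sides make sense: `h` and `ψ ∘ h` are measurable and the
surrogate regret is finite. -/
def Guarantees (X : Type*) {R Y : Type*} {d : ℕ} [MeasurableSpace X] [MeasurableSpace R]
    [MeasurableSpace Y] (L : (Fin d → ℝ) → Y → ℝ≥0) (ψ : (Fin d → ℝ) → R)
    (ℓ : R → Y → ℝ≥0) (ζ : ℝ≥0 → ℝ≥0) : Prop :=
  ∀ D : Measure (X × Y), IsProbabilityMeasure D →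
    ∀ h : X → (Fin d → ℝ), Measurable h → Measurable (ψ ∘ h) → regret L h D ≠ ⊤ →
      regret ℓ (ψ ∘ h) D ≤ (ζ (regret L h D).toNNReal : ℝ≥0∞)

/-- `(L, ψ)` is consistent for `ℓ`: it guarantees some regret transfer. -/
def Consistent (X : Type*) {R Y : Type*} {d : ℕ} [MeasurableSpace X] [MeasurableSpace R]
    [MeasurableSpace Y] (L : (Fin d → ℝ) → Y → ℝ≥0) (ψ : (Fin d → ℝ) → R)
    (ℓ : R → Y → ℝ≥0) : Prop :=
  ∃ ζ : ℝ≥0 → ℝ≥0, IsRegretTransfer ζ ∧ Guarantees X L ψ ℓ ζ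

/-- `(L, ψ)` guarantees a linear regret transfer for `ℓ`. -/
def LinearTransfer (X : Type*) {R Y : Type*} {d : ℕ} [MeasurableSpace X] [MeasurableSpace R]
    [MeasurableSpace Y] (L : (Fin d → ℝ) → Y → ℝ≥0) (ψ : (Fin d → ℝ) → R)
    (ℓ : R → Y → ℝ≥0) : Prop :=
  ∃ α : ℝ≥0, Guarantees X L ψ ℓ (fun t => α * t)

/-! ### Separation and the constants -/

/-- `ψ` is `ε`-separated with respect to `L` and `ℓ`: for every distribution `p`, each `u`
that links to a suboptimal target report has `d_∞(u, Γ(p)) > ε`. -/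
def Separated {R Y : Type*} {d : ℕ} [Fintype Y] (L : (Fin d → ℝ) → Y → ℝ≥0)
    (ψ : (Fin d → ℝ) → R) (ℓ : R → Y → ℝ≥0) (ε : ℝ≥0) : Prop :=
  ∀ p ∈ stdSimplex ℝ Y, ∀ u, ψ u ∉ prop ℓ p → (ε : ℝ) < Metric.infDist u (prop L p)

/-- `ε_ψ`, the supremum of the `ε` for which `ψ` is `ε`-separated, in `[0,∞]`. -/
def epsLink {R Y : Type*} {d : ℕ} [Fintype Y] (L : (Fin d → ℝ) → Y → ℝ≥0)
    (ψ : (Fin d → ℝ) → R) (ℓ : R → Y → ℝ≥0) : ℝ≥0∞ :=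
  ⨆ (ε : ℝ≥0) (_ : Separated L ψ ℓ ε), (ε : ℝ≥0∞)

/-- `C_ℓ = max_{r, r', y} (ℓ(r)_y - ℓ(r')_y)`. The truncated subtraction of `ℝ≥0` gives the
same maximum, since `r = r'` contributes `0`. -/
def lossRange {R Y : Type*} [Fintype R] [Fintype Y] (ℓ : R → Y → ℝ≥0) : ℝ≥0 :=
  Finset.univ.sup (fun t : R × R × Y => ℓ t.1 t.2.2 - ℓ t.2.1 t.2.2)

/-- `H_{L,p}`, the smallest `H ≥ 0` with `d_∞(u, Γ(p)) ≤ H · R_L(u, p)` for all `u`. -/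
def hoffmanAt {Y : Type*} {d : ℕ} [Fintype Y] (L : (Fin d → ℝ) → Y → ℝ≥0) (p : Y → ℝ) : ℝ≥0 :=
  sInf {H : ℝ≥0 | ∀ u, Metric.infDist u (prop L p) ≤ (H : ℝ) * condRegret L u p}

/-- The vertices of the full-dimensional level sets of the property elicited by `L`.
Full-dimensional means: of the same dimension as the probability simplex. -/
def levelVertices {Y : Type*} {d : ℕ} [Fintype Y] (L : (Fin d → ℝ) → Y → ℝ≥0) :
    Set (Y → ℝ) :=
  {p | ∃ u, affineSpan ℝ (levelSet L u) = affineSpan ℝ (stdSimplex ℝ Y) ∧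
    p ∈ (levelSet L u).extremePoints ℝ}

/-- `H_L`, the maximum of `H_{L,p}` over these (finitely many) vertices. -/
def hoffman {Y : Type*} {d : ℕ} [Fintype Y] (L : (Fin d → ℝ) → Y → ℝ≥0) : ℝ≥0 :=
  sSup (hoffmanAt L '' levelVertices L)

/-- The constant `C_ℓ H_L / ε_ψ`. The quotient is taken in `[0,∞]`, so it is `0` if
`ε_ψ = ∞`; it is finite as soon as `ε_ψ > 0`. -/
def transferConst {R Y : Type*} {d : ℕ} [Fintype R] [Fintype Y]
    (L : (Fin d → ℝ) → Y → ℝ≥0) (ψ : (Fin d → ℝ) → R) (ℓ : R → Y → ℝ≥0) : ℝ≥0 :=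
  ((lossRange ℓ : ℝ≥0∞) * (hoffman L : ℝ≥0∞) / epsLink L ψ ℓ).toNNReal

end

end SurrogateRegret

/-! Separation gives the linear transfer as follows. If `ψ u` is suboptimal at `p`, its target
regret is at most `C_ℓ`, while `u` is at distance at least `ε_ψ` from `Γ(p)`. Hoffman's error bound
(`exists_hoffman_bound`), applied to the polyhedral function `⟨p, L(·)⟩`, says that this distance is
at most `H_{L,p}` times the surrogate regret. Hence the target regret is at most `C_ℓ H_{L,p} / ε_ψ`
times the surrogate regret.

To make the constant uniform in `p`, note that on a level set of `L` the Bayes risk of `L` is linear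
in `p`, so the comparison with any fixed target report is a linear inequality there and need only
hold at the vertices. The full-dimensional level sets cover the simplex and have finitely many
vertices in all, so the largest `H_{L,p}` among these suffices. Disintegrating the distribution over
`X` then integrates the conditional bound.

Conversely, let `u` be close to `v ∈ Γ(p)` with `ψ u ∉ γ(p)`. Level sets of `ℓ` are closed and
convex, so `ψ u` is also suboptimal at some vertex `q` of the level set of `v`. There the surrogate
regret of `u` is small, since `v` is optimal and `L` is Lipschitz, but the target regret is bounded
below, as there are finitely many vertices and reports. A regret transfer excludes this
(`Consistent.exists_separated`). -/

namespace SurrogateRegret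

/-! ### Hoffman's error bound -/

/-- **Hoffman's error bound** for a finite system of affine inequalities `a i ⬝ᵥ u + b i ≤ 0`,
proved by Fourier–Motzkin elimination. It suffices that the system is approximately feasible. -/
theorem exists_hoffman_bound (d : ℕ) : ∀ {ι : Type*} [Fintype ι] (a : ι → Fin d → ℝ) (b : ι → ℝ),
    (∀ ε > 0, ∃ u, ∀ i, a i ⬝ᵥ u + b i ≤ ε) →
    ∃ H : ℝ, 0 ≤ H ∧ ∀ u δ, 0 ≤ δ → (∀ i, a i ⬝ᵥ u + b i ≤ δ) →
      ∃ v, (∀ i, a i ⬝ᵥ v + b i ≤ 0) ∧ dist u v ≤ H * δ := by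
  induction d with
  | zero =>
    intro ι _ a b h
    refine ⟨0, le_rfl, fun u δ _ _ => ⟨u, fun i => ?_, by simp⟩⟩
    refine le_of_forall_pos_le_add fun ε hε => ?_
    obtain ⟨w, hw⟩ := h ε hε
    simpa [dotProduct] using hw i
  | succ d ih =>
    intro ι _ a b h
    -- `K` bounds every elimination multiplier: the `1` covers rows that are kept unscaled, and rows
    -- with zero leading coefficient contribute `0⁻¹ = 0`.
    set K : ℝ := 1 + ∑ i, |a i 0|⁻¹ with hK
    have hK1 : 1 ≤ K := by
      have : 0 ≤ ∑ i, |a i 0|⁻¹ := Finset.sum_nonneg fun i _ => by positivity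
      linarith
    have hKi : ∀ i, |a i 0|⁻¹ ≤ K := fun i => by
      have := Finset.single_le_sum (f := fun i => |a i 0|⁻¹) (fun i _ => by positivity)
        (Finset.mem_univ i)
      linarith
    set M : ℝ := ∑ i, ∑ k : Fin d, |a i k.succ| with hM
    have hM0 : 0 ≤ M := Finset.sum_nonneg fun i _ => Finset.sum_nonneg fun k _ => abs_nonneg _
    have hlip : ∀ i (w w' : Fin d → ℝ),
        Fin.tail (a i) ⬝ᵥ w' ≤ Fin.tail (a i) ⬝ᵥ w + M * dist w w' := by
      intro i w w'
      have h1 : Fin.tail (a i) ⬝ᵥ w' - Fin.tail (a i) ⬝ᵥ w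
          ≤ (∑ k : Fin d, |a i k.succ|) * dist w w' := by
        rw [← dotProduct_sub, dotProduct, Finset.sum_mul]
        refine Finset.sum_le_sum fun k _ => (le_abs_self _).trans ?_
        rw [abs_mul]
        refine mul_le_mul_of_nonneg_left ?_ (abs_nonneg _)
        rw [dist_comm, dist_eq_norm]
        exact norm_le_pi_norm (w' - w) k
      have h2 : ∑ k : Fin d, |a i k.succ| ≤ M :=
        Finset.single_le_sum (f := fun i => ∑ k : Fin d, |a i k.succ|)
          (fun i _ => Finset.sum_nonneg fun k _ => abs_nonneg _) (Finset.mem_univ i)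
      nlinarith [dist_nonneg (x := w) (y := w')]
    have hsplit : ∀ i (u : Fin (d + 1) → ℝ),
        a i ⬝ᵥ u = a i 0 * u 0 + Fin.tail (a i) ⬝ᵥ Fin.tail u := fun i u => by
      simp [dotProduct, Fin.sum_univ_succ, Fin.tail]
    -- the multipliers of the eliminated system
    obtain ⟨m, hm0, hmK, hmc, hmz, hmp⟩ : ∃ m : ι × ι → ℝ × ℝ,
        (∀ q, 0 ≤ (m q).1 ∧ 0 ≤ (m q).2) ∧ (∀ q, (m q).1 ≤ K ∧ (m q).2 ≤ K) ∧
        (∀ q, (m q).1 * a q.1 0 + (m q).2 * a q.2 0 = 0) ∧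
        (∀ q, a q.1 0 = 0 → m q = (1, 0)) ∧
        (∀ q, 0 < a q.1 0 → a q.2 0 < 0 → m q = ((a q.1 0)⁻¹, (-a q.2 0)⁻¹)) := by
      classical
      -- Rows free of the first coordinate are kept, a positive and a negative row are combined so
      -- that it cancels, and every other pair yields the void row `0 ≤ 0`.
      refine ⟨fun q => if a q.1 0 = 0 then (1, 0) else
        if 0 < a q.1 0 ∧ a q.2 0 < 0 then ((a q.1 0)⁻¹, (-a q.2 0)⁻¹) else (0, 0),
        fun q => ?_, fun q => ?_, fun q => ?_, fun q h0 => ?_, fun q h1 h2 => ?_⟩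
      · dsimp only
        split_ifs with h1 h2
        · simp
        · exact ⟨inv_nonneg.2 h2.1.le, inv_nonneg.2 (by linarith [h2.2])⟩
        · simp
      · dsimp only
        split_ifs with h1 h2
        · exact ⟨hK1, by linarith⟩
        · have e1 := hKi q.1
          have e2 := hKi q.2
          rw [abs_of_pos h2.1] at e1
          rw [abs_of_neg h2.2] at e2
          exact ⟨e1, e2⟩
        · exact ⟨by linarith, by linarith⟩
      · dsimp only
        split_ifs with h1 h2
        · simp [h1]
        · have := h2.1.ne'
          have := h2.2.ne
          simp only [inv_neg]
          field_simp
          ring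
        · simp
      · simp [h0]
      · simp [h1.ne', h1, h2]
    have hcomb : ∀ (q : ι × ι) (u : Fin (d + 1) → ℝ) (δ : ℝ), 0 ≤ δ →
        (∀ i, a i ⬝ᵥ u + b i ≤ δ) →
        ((m q).1 • Fin.tail (a q.1) + (m q).2 • Fin.tail (a q.2)) ⬝ᵥ Fin.tail u
          + ((m q).1 * b q.1 + (m q).2 * b q.2) ≤ 2 * K * δ := by
      intro q u δ hδ hu
      have e1 := hu q.1
      have e2 := hu q.2
      rw [hsplit] at e1 e2
      rw [add_dotProduct, smul_dotProduct, smul_dotProduct, smul_eq_mul, smul_eq_mul]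
      have f1 := mul_le_mul_of_nonneg_left e1 (hm0 q).1
      have f2 := mul_le_mul_of_nonneg_left e2 (hm0 q).2
      have g1 := mul_le_mul_of_nonneg_right (hmK q).1 hδ
      have g2 := mul_le_mul_of_nonneg_right (hmK q).2 hδ
      have := congrArg (· * u 0) (hmc q)
      nlinarith
    obtain ⟨H, hH0, hH⟩ := ih
      (fun q : ι × ι => (m q).1 • Fin.tail (a q.1) + (m q).2 • Fin.tail (a q.2))
      (fun q => (m q).1 * b q.1 + (m q).2 * b q.2) (by
        intro ε hε
        obtain ⟨u, hu⟩ := h (ε / (2 * K)) (by positivity)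
        refine ⟨Fin.tail u, fun q => (hcomb q u _ (by positivity) hu).trans (le_of_eq ?_)⟩
        field_simp)
    refine ⟨K * (1 + M * (H * (2 * K))) + H * (2 * K), by positivity, fun u δ hδ hu => ?_⟩
    obtain ⟨w, hw, hdw⟩ := hH (Fin.tail u) (2 * K * δ) (by positivity)
      (fun q => hcomb q u δ hδ hu)
    -- `δ'` bounds the violation at `(u 0, w)`: the original `δ` plus the change caused by moving
    -- the tail of `u` to `w`.
    set δ' : ℝ := δ + M * (H * (2 * K * δ)) with hδ'
    have hδ'0 : 0 ≤ δ' := by positivity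
    have hα : ∀ i, a i 0 * u 0 + (Fin.tail (a i) ⬝ᵥ w + b i) ≤ δ' := by
      intro i
      have e1 := hu i
      rw [hsplit] at e1
      have e2 := hlip i (Fin.tail u) w
      have e3 := mul_le_mul_of_nonneg_left hdw hM0
      linarith
    set α : ι → ℝ := fun i => Fin.tail (a i) ⬝ᵥ w + b i with hαdef
    have hdiv : ∀ i, a i 0 ≠ 0 → δ' / |a i 0| ≤ K * δ' := fun i _ => by
      rw [div_eq_inv_mul]
      exact mul_le_mul_of_nonneg_right (hKi i) hδ'0
    have hlow : ∀ j, a j 0 < 0 → α j / (-a j 0) ≤ u 0 + K * δ' := by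
      intro j hj
      have e1 := hdiv j hj.ne
      rw [abs_of_neg hj] at e1
      have e2 : α j / (-a j 0) ≤ u 0 + δ' / (-a j 0) := by
        have hj' : 0 < -a j 0 := by linarith
        rw [div_le_iff₀ hj', add_mul, div_mul_cancel₀ _ hj'.ne']
        have := hα j
        linarith
      linarith
    have hup : ∀ i, 0 < a i 0 → u 0 - K * δ' ≤ -α i / a i 0 := by
      intro i hi
      have e1 := hdiv i hi.ne'
      rw [abs_of_pos hi] at e1
      have e2 : u 0 - δ' / a i 0 ≤ -α i / a i 0 := by
        rw [le_div_iff₀ hi, sub_mul, div_mul_cancel₀ _ hi.ne']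
        have := hα i
        linarith
      linarith
    have hlu : ∀ i j, 0 < a i 0 → a j 0 < 0 → α j / (-a j 0) ≤ -α i / a i 0 := by
      intro i j hi hj
      have e1 := hw (i, j)
      rw [hmp (i, j) hi hj, add_dotProduct, smul_dotProduct, smul_dotProduct, smul_eq_mul,
        smul_eq_mul] at e1
      rw [div_eq_inv_mul, div_eq_inv_mul]
      simp only [hαdef]
      linarith
    -- Adding `u 0 ± K * δ'` to the lower and upper bounds on the eliminated coordinate keeps `t`
    -- near `u 0`, and makes both sets nonempty.
    obtain ⟨t, ht1, ht2⟩ := exists_between_of_forall_le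
      (s := insert (u 0 - K * δ') {x | ∃ j, a j 0 < 0 ∧ x = α j / (-a j 0)})
      (t := insert (u 0 + K * δ') {x | ∃ i, 0 < a i 0 ∧ x = -α i / a i 0})
      (Set.insert_nonempty _ _) (Set.insert_nonempty _ _) (by
        have : 0 ≤ K * δ' := by positivity
        rintro x (rfl | ⟨j, hj, rfl⟩) y (rfl | ⟨i, hi, rfl⟩)
        · linarith
        · exact hup i hi
        · exact hlow j hj
        · exact hlu i j hi hj)
    refine ⟨Fin.cons t w, fun i => ?_, ?_⟩
    · rw [hsplit, Fin.cons_zero, Fin.tail_cons]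
      rcases lt_trichotomy (a i 0) 0 with hi | hi | hi
      · have e := ht1 (Set.mem_insert_of_mem _ ⟨i, hi, rfl⟩)
        rw [div_le_iff₀ (by linarith)] at e
        simp only [hαdef] at e
        linarith
      · have e := hw (i, i)
        rw [hmz (i, i) hi] at e
        simp only [one_smul, zero_smul, add_zero, one_mul, zero_mul] at e
        rw [hi]
        linarith
      · have e := ht2 (Set.mem_insert_of_mem _ ⟨i, hi, rfl⟩)
        rw [le_div_iff₀ hi] at e
        simp only [hαdef] at e
        linarith
    · have hb : 0 ≤ H * (2 * K * δ) := by positivity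
      have e0 : (K * (1 + M * (H * (2 * K))) + H * (2 * K)) * δ
          = K * δ' + H * (2 * K * δ) := by rw [hδ']; ring
      rw [e0, dist_pi_le_iff (by positivity)]
      intro k
      refine Fin.cases ?_ (fun k => ?_) k
      · have e1 := ht1 (Set.mem_insert _ _)
        have e2 := ht2 (Set.mem_insert _ _)
        rw [Fin.cons_zero, Real.dist_eq, abs_le]
        constructor <;> linarith
      · rw [Fin.cons_succ]
        have := (dist_le_pi_dist (Fin.tail u) w k).trans hdw
        have h0 : 0 ≤ K * δ' := by positivity
        simp only [Fin.tail] at this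
        linarith

/-! ### Bayes risk, regret and level sets of general losses -/

section Losses

variable {R Y : Type*} [Fintype Y]

theorem expLoss_nonneg (f : R → Y → ℝ≥0) {p : Y → ℝ} (hp : p ∈ stdSimplex ℝ Y) (r : R) :
    0 ≤ expLoss f p r :=
  Finset.sum_nonneg fun y _ => mul_nonneg (hp.1 y) (f r y).2

theorem bddBelow_expLoss (f : R → Y → ℝ≥0) {p : Y → ℝ} (hp : p ∈ stdSimplex ℝ Y) :
    BddBelow (Set.range (expLoss f p)) :=
  ⟨0, by rintro _ ⟨r, rfl⟩; exact expLoss_nonneg f hp r⟩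

theorem bayesRisk_le (f : R → Y → ℝ≥0) {p : Y → ℝ} (hp : p ∈ stdSimplex ℝ Y) (r : R) :
    bayesRisk f p ≤ expLoss f p r :=
  ciInf_le (bddBelow_expLoss f hp) r

theorem condRegret_nonneg (f : R → Y → ℝ≥0) {p : Y → ℝ} (hp : p ∈ stdSimplex ℝ Y) (r : R) :
    0 ≤ condRegret f r p :=
  sub_nonneg.2 (bayesRisk_le f hp r)

theorem bayesRisk_eq_of_mem_prop {f : R → Y → ℝ≥0} {p : Y → ℝ} (hp : p ∈ stdSimplex ℝ Y) {r : R}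
    (hr : r ∈ prop f p) : bayesRisk f p = expLoss f p r :=
  haveI : Nonempty R := ⟨r⟩
  le_antisymm (bayesRisk_le f hp r) (le_ciInf hr)

theorem mem_prop_of_expLoss_le_bayesRisk {f : R → Y → ℝ≥0} {p : Y → ℝ} (hp : p ∈ stdSimplex ℝ Y)
    {r : R} (hr : expLoss f p r ≤ bayesRisk f p) : r ∈ prop f p :=
  fun r' => hr.trans (bayesRisk_le f hp r')

theorem condRegret_pos {f : R → Y → ℝ≥0} {p : Y → ℝ} (hp : p ∈ stdSimplex ℝ Y) {r : R}
    (hr : r ∉ prop f p) : 0 < condRegret f r p := by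
  by_contra h
  exact hr (mem_prop_of_expLoss_le_bayesRisk hp (by unfold condRegret at h; linarith))

theorem continuous_expLoss (f : R → Y → ℝ≥0) (r : R) : Continuous fun p => expLoss f p r := by
  unfold expLoss
  fun_prop

theorem expLoss_add (f : R → Y → ℝ≥0) (p q : Y → ℝ) (r : R) :
    expLoss f (p + q) r = expLoss f p r + expLoss f q r := by
  simp [expLoss, add_mul, Finset.sum_add_distrib]

theorem expLoss_smul (f : R → Y → ℝ≥0) (c : ℝ) (p : Y → ℝ) (r : R) :
    expLoss f (c • p) r = c * expLoss f p r := by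
  simp [expLoss, Finset.mul_sum, mul_assoc]

theorem isClosed_levelSet (f : R → Y → ℝ≥0) (r : R) : IsClosed (levelSet f r) := by
  have : levelSet f r = stdSimplex ℝ Y ∩ ⋂ r', {p | expLoss f p r ≤ expLoss f p r'} := by
    ext p; simp [levelSet, prop]
  rw [this]
  exact (isClosed_stdSimplex ℝ Y).inter
    (isClosed_iInter fun r' => isClosed_le (continuous_expLoss f r) (continuous_expLoss f r'))

theorem isCompact_levelSet (f : R → Y → ℝ≥0) (r : R) : IsCompact (levelSet f r) :=
  (isCompact_stdSimplex ℝ Y).of_isClosed_subset (isClosed_levelSet f r) fun _ h => h.1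

theorem convex_levelSet (f : R → Y → ℝ≥0) (r : R) : Convex ℝ (levelSet f r) := by
  intro p hp q hq a b ha hb hab
  refine ⟨convex_stdSimplex ℝ Y hp.1 hq.1 ha hb hab, fun r' => ?_⟩
  simp only [expLoss_add, expLoss_smul]
  exact add_le_add (mul_le_mul_of_nonneg_left (hp.2 r') ha)
    (mul_le_mul_of_nonneg_left (hq.2 r') hb)

/-- A closed convex set that contains the extreme points of a level set contains the level set. -/
theorem levelSet_subset_of_extremePoints_subset {f : R → Y → ℝ≥0} {r : R} {s : Set (Y → ℝ)}
    (hc : IsClosed s) (hs : Convex ℝ s) (h : (levelSet f r).extremePoints ℝ ⊆ s) :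
    levelSet f r ⊆ s := by
  rw [← closure_convexHull_extremePoints (isCompact_levelSet f r) (convex_levelSet f r)]
  exact closure_minimal (convexHull_min h hs) hc

end Losses

/-! ### Error bound and level sets of polyhedral losses -/

section Polyhedral

variable {Y : Type*} {d : ℕ} {L : (Fin d → ℝ) → Y → ℝ≥0}

theorem PolyhedralLoss.exists_pieces (hL : PolyhedralLoss L) :
    ∃ s : Y → Finset ((Fin d → ℝ) →ᵃ[ℝ] ℝ),
      (∀ y u, ∀ g ∈ s y, g u ≤ (L u y : ℝ)) ∧ ∀ y u, ∃ g ∈ s y, g u = (L u y : ℝ) := by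
  choose s hs h using hL
  refine ⟨s, fun y u g hg => ?_, fun y u => ?_⟩
  · simp only [h y u]
    exact Finset.le_sup' (fun g : (Fin d → ℝ) →ᵃ[ℝ] ℝ => g u) hg
  · obtain ⟨g, hg, e⟩ := Finset.exists_mem_eq_sup' (hs y)
      (fun g : (Fin d → ℝ) →ᵃ[ℝ] ℝ => g u)
    exact ⟨g, hg, e.symm.trans (h y u).symm⟩

theorem affineMap_apply_eq_dotProduct (g : (Fin d → ℝ) →ᵃ[ℝ] ℝ) (u : Fin d → ℝ) :
    g u = (fun k => g.linear (Pi.single k 1)) ⬝ᵥ u + g 0 := by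
  have h1 : g u = g.linear u + g 0 := congrFun (AffineMap.decomp g) u
  have h2 : u = ∑ k, u k • Pi.single (M := fun _ => ℝ) k 1 := by
    ext j
    simp [Pi.single_apply]
  rw [h1]
  nth_rw 1 [h2]
  simp [dotProduct, mul_comm]

/-- The expected loss of a polyhedral loss has a linear error bound; in particular it attains its
infimum. -/
theorem PolyhedralLoss.exists_error_bound [Fintype Y] (hL : PolyhedralLoss L) {p : Y → ℝ}
    (hp : p ∈ stdSimplex ℝ Y) :
    ∃ H : ℝ, 0 ≤ H ∧ ∀ u, ∃ v ∈ prop L p, dist u v ≤ H * condRegret L u p := by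
  classical
  obtain ⟨s, hle, hex⟩ := hL.exists_pieces
  -- The conditional regret is the maximum of affine functions indexed by a choice `c` of one piece
  -- per label; its zero set, `prop L p`, is thus the solution set of a finite system. Approximate
  -- feasibility is all that the definition of the infimum supplies.
  set a : (∀ y, s y) → Fin d → ℝ := fun c k => ∑ y, p y * (c y).1.linear (Pi.single k 1)
  set b : (∀ y, s y) → ℝ := fun c => ∑ y, p y * (c y).1 0 - bayesRisk L p
  have hab : ∀ c u, a c ⬝ᵥ u + b c = ∑ y, p y * (c y).1 u - bayesRisk L p := by
    intro c u
    have : a c ⬝ᵥ u = ∑ y, p y * ((fun k => (c y).1.linear (Pi.single k 1)) ⬝ᵥ u) := by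
      simp only [a, dotProduct, Finset.sum_mul, Finset.mul_sum]
      rw [Finset.sum_comm]
      simp only [mul_assoc]
    simp only [affineMap_apply_eq_dotProduct _ u, mul_add, Finset.sum_add_distrib, this, b]
    ring
  have hup : ∀ c u, a c ⬝ᵥ u + b c ≤ condRegret L u p := by
    intro c u
    rw [hab]
    exact sub_le_sub_right (Finset.sum_le_sum fun y _ =>
      mul_le_mul_of_nonneg_left (hle y u _ (c y).2) (hp.1 y)) _
  obtain ⟨H, hH0, hH⟩ := exists_hoffman_bound d a b (by
    intro ε hε
    obtain ⟨u, hu⟩ := exists_lt_of_ciInf_lt (show bayesRisk L p < bayesRisk L p + ε by linarith)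
    refine ⟨u, fun c => (hup c u).trans ?_⟩
    unfold condRegret
    linarith)
  refine ⟨H, hH0, fun u => ?_⟩
  obtain ⟨v, hv, hd⟩ := hH u _ (condRegret_nonneg L hp u) (fun c => hup c u)
  refine ⟨v, mem_prop_of_expLoss_le_bayesRisk hp ?_, hd⟩
  choose g hg hgv using fun y => hex y v
  have := hv fun y => ⟨g y, hg y⟩
  rw [hab] at this
  simp only [hgv] at this
  unfold expLoss
  linarith

theorem PolyhedralLoss.prop_nonempty [Fintype Y] (hL : PolyhedralLoss L) {p : Y → ℝ}
    (hp : p ∈ stdSimplex ℝ Y) : (prop L p).Nonempty := by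
  obtain ⟨H, -, h⟩ := hL.exists_error_bound hp
  obtain ⟨v, hv, -⟩ := h 0
  exact ⟨v, hv⟩

/-- The infimum defining `hoffmanAt` is attained: the admissible constants form a closed set,
nonempty by the error bound. -/
theorem PolyhedralLoss.infDist_le_hoffmanAt_mul [Fintype Y] (hL : PolyhedralLoss L) {p : Y → ℝ}
    (hp : p ∈ stdSimplex ℝ Y) (u : Fin d → ℝ) :
    Metric.infDist u (prop L p) ≤ hoffmanAt L p * condRegret L u p := by
  have hne : {H : ℝ≥0 | ∀ u, Metric.infDist u (prop L p) ≤ (H : ℝ) * condRegret L u p}.Nonempty := by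
    obtain ⟨H, hH0, h⟩ := hL.exists_error_bound hp
    refine ⟨⟨H, hH0⟩, fun u => ?_⟩
    obtain ⟨v, hv, hd⟩ := h u
    exact (Metric.infDist_le_dist_of_mem hv).trans hd
  have hcl : IsClosed
      {H : ℝ≥0 | ∀ u, Metric.infDist u (prop L p) ≤ (H : ℝ) * condRegret L u p} := by
    simp only [Set.ofPred_forall]
    exact isClosed_iInter fun u => isClosed_le (by fun_prop) (by fun_prop)
  exact hcl.csInf_mem hne (OrderBot.bddBelow _) u

/-- The level set at `u` depends only on which affine pieces are active at `u`. -/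
theorem levelSet_subset_of_active_subset [Fintype Y] {s : Y → Finset ((Fin d → ℝ) →ᵃ[ℝ] ℝ)}
    (hle : ∀ y u, ∀ g ∈ s y, g u ≤ (L u y : ℝ)) (hex : ∀ y u, ∃ g ∈ s y, g u = (L u y : ℝ))
    {u v : Fin d → ℝ} (huv : ∀ y, ∀ g ∈ s y, g u = (L u y : ℝ) → g v = (L v y : ℝ)) :
    levelSet L u ⊆ levelSet L v := by
  classical
  rintro p ⟨hp, hu⟩
  refine ⟨hp, fun w => ?_⟩
  set D := w - v with hD
  -- Among the pieces active at `u`, the steepest one in direction `D` computes the loss on a short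
  -- ray from `u`. Optimality of `u` makes the mean slope nonnegative, and since the same pieces are
  -- active at `v`, they bound the loss at `w = v + D` from below.
  have hmax : ∀ y, ∃ g ∈ s y, g u = (L u y : ℝ) ∧
      ∀ g' ∈ s y, g' u = (L u y : ℝ) → g'.linear D ≤ g.linear D := by
    intro y
    obtain ⟨g₀, hg₀, e₀⟩ := hex y u
    obtain ⟨g, hg, hmax⟩ := Finset.exists_max_image ((s y).filter fun g => g u = (L u y : ℝ))
      (fun g => g.linear D) ⟨g₀, by simp [hg₀, e₀]⟩
    rw [Finset.mem_filter] at hg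
    exact ⟨g, hg.1, hg.2, fun g' h1 h2 => hmax g' (by simp [h1, h2])⟩
  choose g hg hgu hgm using hmax
  have hline : ∀ (g : (Fin d → ℝ) →ᵃ[ℝ] ℝ) (x : Fin d → ℝ) (t : ℝ),
      g (x + t • D) = g x + t * g.linear D := by
    intro g x t
    rw [add_comm x, ← vadd_eq_add, AffineMap.map_vadd, map_smul, vadd_eq_add, smul_eq_mul,
      add_comm]
  have hev : ∀ᶠ t in nhdsWithin (0 : ℝ) (Set.Ioi 0), ∀ y, ∀ g' ∈ s y,
      g' (u + t • D) ≤ g y (u + t • D) := by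
    rw [Filter.eventually_all]
    intro y
    rw [Filter.eventually_all_finset]
    intro g' hg'
    rcases (hle y u g' hg').lt_or_eq with hlt | heq
    · have hc : ContinuousAt (fun t : ℝ => g y u + t * (g y).linear D
          - (g' u + t * g'.linear D)) 0 := by fun_prop
      have := hc.eventually (lt_mem_nhds (a := 0) (by simp [hgu]; exact hlt))
      filter_upwards [nhdsWithin_le_nhds this] with t ht
      rw [hline, hline]
      linarith
    · filter_upwards [self_mem_nhdsWithin] with t (ht : 0 < t)
      rw [hline, hline, heq, hgu]
      have := mul_le_mul_of_nonneg_left (hgm y g' hg' heq) ht.le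
      linarith
  obtain ⟨t, ht, ht0⟩ := (hev.and self_mem_nhdsWithin).exists
  have ht0 : 0 < t := ht0
  have hslope : 0 ≤ ∑ y, p y * (g y).linear D := by
    have h1 := hu (u + t • D)
    have h2 : expLoss L p (u + t • D) = expLoss L p u + t * ∑ y, p y * (g y).linear D := by
      simp only [expLoss, Finset.mul_sum, ← Finset.sum_add_distrib]
      refine Finset.sum_congr rfl fun y _ => ?_
      obtain ⟨g', hg', e'⟩ := hex y (u + t • D)
      have e1 : (L (u + t • D) y : ℝ) = g y (u + t • D) :=
        le_antisymm (e' ▸ ht y g' hg') (hle y _ _ (hg y))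
      rw [e1, hline, hgu]
      ring
    have h3 : 0 ≤ t * ∑ y, p y * (g y).linear D := by linarith
    exact nonneg_of_mul_nonneg_right h3 ht0
  have hw : expLoss L p v + ∑ y, p y * (g y).linear D ≤ expLoss L p w := by
    simp only [expLoss, ← Finset.sum_add_distrib, ← mul_add]
    refine Finset.sum_le_sum fun y _ => mul_le_mul_of_nonneg_left ?_ (hp.1 y)
    have e := hline (g y) v 1
    rw [one_smul, one_mul, hD, add_sub_cancel] at e
    have := hle y w (g y) (hg y)
    rw [e, huv y _ (hg y) (hgu y)] at this
    exact this
  linarith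

theorem PolyhedralLoss.finite_range_levelSet [Fintype Y] (hL : PolyhedralLoss L) :
    (Set.range (levelSet L)).Finite := by
  classical
  obtain ⟨s, hle, hex⟩ := hL.exists_pieces
  let A : (Fin d → ℝ) → ∀ y, Set (s y) := fun u y => {g | g.1 u = (L u y : ℝ)}
  have hfac : ∀ u v, A u = A v → levelSet L u ⊆ levelSet L v := fun u v h =>
    levelSet_subset_of_active_subset hle hex fun y g hg hgu => by
      have : (⟨g, hg⟩ : s y) ∈ A u y := hgu
      rw [h] at this
      exact this
  have : (Set.range fun u => (A u, levelSet L u)).Finite := by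
    refine Set.Finite.of_injOn (f := Prod.fst) (t := Set.univ) (fun _ _ => Set.mem_univ _) ?_
      Set.finite_univ
    rintro _ ⟨u, rfl⟩ _ ⟨v, rfl⟩ h
    exact Prod.ext h ((hfac u v h).antisymm (hfac v u h.symm))
  refine (this.image Prod.snd).subset ?_
  rintro _ ⟨u, rfl⟩
  exact ⟨_, ⟨u, rfl⟩, rfl⟩

/-- Finitely many reports suffice to attain the Bayes risk everywhere. -/
theorem PolyhedralLoss.exists_finite_representative [Fintype Y] (hL : PolyhedralLoss L) :
    ∃ T : Finset (Fin d → ℝ), ∀ p ∈ stdSimplex ℝ Y, ∃ u ∈ T, u ∈ prop L p := by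
  classical
  choose! g hg using fun (S : Set (Y → ℝ)) (hS : S ∈ Set.range (levelSet L)) => hS
  have hT := hL.finite_range_levelSet.image g
  refine ⟨hT.toFinset, fun p hp => ?_⟩
  obtain ⟨v, hv⟩ := hL.prop_nonempty hp
  have hp' : p ∈ levelSet L (g (levelSet L v)) := by
    rw [hg _ ⟨v, rfl⟩]
    exact ⟨hp, hv⟩
  exact ⟨g (levelSet L v), hT.mem_toFinset.2 ⟨_, ⟨v, rfl⟩, rfl⟩, hp'.2⟩

end Polyhedral

/-! ### Vertices of level sets and the full-dimensional cover -/

section Vertices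

variable {Y : Type*} [Fintype Y] {d : ℕ} {L : (Fin d → ℝ) → Y → ℝ≥0}

/-- An extreme point `p` is determined by its zero coordinates and the members of the finite set `T`
optimal at it. If `q` in the level set has the same pattern, `p + t • (p - q)` stays in the level
set for small `t > 0`, which puts `p` between it and `q`. -/
theorem PolyhedralLoss.finite_extremePoints_levelSet (hL : PolyhedralLoss L) (u : Fin d → ℝ) :
    ((levelSet L u).extremePoints ℝ).Finite := by
  classical
  obtain ⟨T, hT⟩ := hL.exists_finite_representative
  refine Set.Finite.of_injOn
    (f := fun p : Y → ℝ => (({y | p y = 0} : Set Y), ({r | r.1 ∈ prop L p} : Set T)))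
    (t := Set.univ) (fun _ _ => Set.mem_univ _) ?_ Set.finite_univ
  intro p hp q hq hpq
  obtain ⟨⟨hpS, hpu⟩, hpe⟩ := hp
  obtain ⟨⟨hqS, hqu⟩, -⟩ := hq
  have hsupp : ∀ y, p y = 0 → q y = 0 := fun y hy => by
    have h1 : y ∈ {y | p y = 0} := hy
    exact (Set.ext_iff.1 (Prod.ext_iff.1 hpq).1 y).1 h1
  have htight : ∀ r ∈ T, r ∈ prop L p → r ∈ prop L q := fun r hr hrp => by
    have h1 : (⟨r, hr⟩ : T) ∈ {r : T | r.1 ∈ prop L p} := hrp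
    exact (Set.ext_iff.1 (Prod.ext_iff.1 hpq).2 _).1 h1
  have hexp : ∀ (t : ℝ) r, expLoss L (p + t • (p - q)) r
      = expLoss L p r + t * (expLoss L p r - expLoss L q r) := fun t r => by
    have : p - q = p + (-1 : ℝ) • q := by simp [sub_eq_add_neg]
    rw [expLoss_add, expLoss_smul, this, expLoss_add, expLoss_smul]
    ring
  have hnn : ∀ᶠ t in nhdsWithin (0 : ℝ) (Set.Ioi 0), ∀ y, 0 ≤ (p + t • (p - q)) y := by
    rw [Filter.eventually_all]
    intro y
    rcases (hpS.1 y).lt_or_eq with h | h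
    · have hc : ContinuousAt (fun t : ℝ => (p + t • (p - q)) y) 0 := by
        simp only [Pi.add_apply, Pi.smul_apply, smul_eq_mul]
        fun_prop
      have := hc.eventually (lt_mem_nhds (a := 0) (by simpa using h))
      filter_upwards [nhdsWithin_le_nhds this] with t ht using ht.le
    · refine Filter.Eventually.of_forall fun t => ?_
      simp [← h, hsupp y h.symm]
  have hopt : ∀ᶠ t in nhdsWithin (0 : ℝ) (Set.Ioi 0), ∀ r ∈ T,
      expLoss L (p + t • (p - q)) u ≤ expLoss L (p + t • (p - q)) r := by
    rw [Filter.eventually_all_finset]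
    intro r hr
    by_cases hrp : r ∈ prop L p
    · refine Filter.Eventually.of_forall fun t => ?_
      rw [hexp, hexp, le_antisymm (hpu r) (hrp u), le_antisymm (hqu r) (htight r hr hrp u)]
    · have hlt : expLoss L p u < expLoss L p r :=
        lt_of_le_of_ne (hpu r) fun e => hrp fun r' => e ▸ hpu r'
      have hc : ContinuousAt (fun t : ℝ => expLoss L (p + t • (p - q)) r
          - expLoss L (p + t • (p - q)) u) 0 := by
        simp only [hexp]
        fun_prop
      have := hc.eventually (lt_mem_nhds (a := 0) (by simpa using hlt))
      filter_upwards [nhdsWithin_le_nhds this] with t ht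
      linarith
  obtain ⟨t, ⟨ht1, ht2⟩, ht0⟩ := ((hnn.and hopt).and self_mem_nhdsWithin).exists
  have ht0 : 0 < t := ht0
  have hxS : p + t • (p - q) ∈ stdSimplex ℝ Y := by
    refine ⟨ht1, ?_⟩
    simp [Finset.sum_add_distrib, ← Finset.mul_sum, hpS.2, hqS.2]
  have hx : p + t • (p - q) ∈ levelSet L u := by
    refine ⟨hxS, fun r' => ?_⟩
    obtain ⟨r, hr, hrp⟩ := hT _ hxS
    exact (ht2 r hr).trans (hrp r')
  have hseg : p ∈ openSegment ℝ q (p + t • (p - q)) := by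
    refine ⟨t / (1 + t), 1 / (1 + t), by positivity, by positivity, by field_simp; ring, ?_⟩
    ext y
    simp only [Pi.add_apply, Pi.smul_apply, Pi.sub_apply, smul_eq_mul]
    field_simp
    ring
  exact (hpe ⟨hqS, hqu⟩ hx hseg).symm

/-- All vertices of all level sets of a polyhedral loss form a finite set. -/
theorem PolyhedralLoss.finite_iUnion_extremePoints (hL : PolyhedralLoss L) :
    (⋃ u, (levelSet L u).extremePoints ℝ).Finite := by
  have : (⋃ u, (levelSet L u).extremePoints ℝ)
      = ⋃ S ∈ Set.range (levelSet L), S.extremePoints ℝ := by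
    rw [Set.biUnion_range]
  rw [this]
  refine hL.finite_range_levelSet.biUnion ?_
  rintro _ ⟨u, rfl⟩
  exact hL.finite_extremePoints_levelSet u

/-- Finiteness of the vertex set is what bounds the supremum; an unbounded one would default to `0`.
-/
theorem PolyhedralLoss.hoffmanAt_le_hoffman (hL : PolyhedralLoss L) {p : Y → ℝ}
    (hp : p ∈ levelVertices L) : hoffmanAt L p ≤ hoffman L := by
  refine le_csSup (Set.Finite.bddAbove ?_) ⟨p, hp, rfl⟩
  refine (hL.finite_iUnion_extremePoints.subset ?_).image _
  rintro q ⟨u, -, hq⟩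
  exact Set.mem_iUnion.2 ⟨u, hq⟩

/-- Any point `q` of `s`, contracted far enough towards `x`, falls into `t`; dilating back from `x`
stays in the affine span of `t`. -/
theorem affineSpan_eq_of_mem_nhdsWithin {E : Type*} [NormedAddCommGroup E] [NormedSpace ℝ E]
    {s t : Set E} (hs : Convex ℝ s) (hts : t ⊆ s) {x : E} (hx : x ∈ s)
    (ht : t ∈ nhdsWithin x s) : affineSpan ℝ t = affineSpan ℝ s := by
  refine le_antisymm (affineSpan_mono ℝ hts) (affineSpan_le.2 fun q hq => ?_)
  have hxt : x ∈ t := mem_of_mem_nhdsWithin hx ht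
  have hlim : Filter.Tendsto (fun r : ℝ => AffineMap.lineMap x q r)
      (nhdsWithin 0 (Set.Ioc 0 1)) (nhdsWithin x s) := by
    refine tendsto_nhdsWithin_iff.2 ⟨?_, ?_⟩
    · have hc : Continuous fun r : ℝ => (AffineMap.lineMap x q r : E) :=
        AffineMap.lineMap_continuous
      have := hc.tendsto 0
      rw [AffineMap.lineMap_apply_zero] at this
      exact this.mono_left nhdsWithin_le_nhds
    · filter_upwards [self_mem_nhdsWithin] with r hr
      exact hs.lineMap_mem hx hq ⟨hr.1.le, hr.2⟩
  have : (nhdsWithin (0 : ℝ) (Set.Ioc 0 1)).NeBot := by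
    rw [nhdsWithin_Ioc_eq_nhdsGT one_pos]
    infer_instance
  obtain ⟨r, hr, hr0⟩ := ((hlim.eventually_mem ht).and self_mem_nhdsWithin).exists
  have h1 := AffineMap.lineMap_mem (r⁻¹) (subset_affineSpan ℝ t hxt) (subset_affineSpan ℝ t hr)
  have hr0' : r ≠ 0 := hr0.1.ne'
  convert h1 using 1
  simp [AffineMap.lineMap_apply, smul_smul, inv_mul_cancel₀ hr0']

/-- The full-dimensional level sets of a polyhedral loss cover the simplex. -/
theorem PolyhedralLoss.exists_fullDim_levelSet (hL : PolyhedralLoss L) {p : Y → ℝ}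
    (hp : p ∈ stdSimplex ℝ Y) :
    ∃ u, affineSpan ℝ (levelSet L u) = affineSpan ℝ (stdSimplex ℝ Y) ∧ p ∈ levelSet L u := by
  obtain ⟨T, hT⟩ := hL.exists_finite_representative
  have : CompactSpace (stdSimplex ℝ Y) := isCompact_iff_compactSpace.1 (isCompact_stdSimplex ℝ Y)
  have hcl : ∀ r : T, IsClosed ((↑) ⁻¹' levelSet L r.1 : Set (stdSimplex ℝ Y)) := fun r =>
    (isClosed_levelSet L r.1).preimage continuous_subtype_val
  -- Baire: the relative interiors of the finitely many closed level sets have dense union, so `p`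
  -- lies in the closure of one of them, which is then nonempty.
  have hd := dense_iUnion_interior_of_closed hcl (by
    refine Set.eq_univ_of_forall fun q => ?_
    obtain ⟨u, hu, hq⟩ := hT q q.2
    exact Set.mem_iUnion.2 ⟨⟨u, hu⟩, q.2, hq⟩)
  have hmem := hd ⟨p, hp⟩
  rw [closure_iUnion_of_finite, Set.mem_iUnion] at hmem
  obtain ⟨r, hr⟩ := hmem
  obtain ⟨x, hx⟩ := closure_nonempty_iff.1 ⟨_, hr⟩
  refine ⟨r, ?_, closure_minimal interior_subset (hcl r) hr⟩
  refine affineSpan_eq_of_mem_nhdsWithin (convex_stdSimplex ℝ Y) (fun _ h => h.1) x.2 ?_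
  exact preimage_coe_mem_nhds_subtype.1 (mem_interior_iff_mem_nhds.1 hx)

end Vertices

/-! ### The conditional regret bound -/

section CondBound

variable {R Y : Type*} [Fintype R] [Fintype Y] {d : ℕ} {L : (Fin d → ℝ) → Y → ℝ≥0}
  {ψ : (Fin d → ℝ) → R} {ℓ : R → Y → ℝ≥0}

theorem expLoss_sub_le_lossRange {p : Y → ℝ} (hp : p ∈ stdSimplex ℝ Y) (r r' : R) :
    expLoss ℓ p r - expLoss ℓ p r' ≤ lossRange ℓ := by
  have h : ∀ y, (ℓ r y : ℝ) - ℓ r' y ≤ lossRange ℓ := fun y => by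
    have h1 : ℓ r y - ℓ r' y ≤ lossRange ℓ :=
      Finset.le_sup (f := fun t : R × R × Y => ℓ t.1 t.2.2 - ℓ t.2.1 t.2.2)
        (Finset.mem_univ (r, r', y))
    have h2 := tsub_le_iff_right.1 h1
    have h3 : (ℓ r y : ℝ) ≤ lossRange ℓ + ℓ r' y := by exact_mod_cast h2
    linarith
  calc expLoss ℓ p r - expLoss ℓ p r' = ∑ y, p y * ((ℓ r y : ℝ) - ℓ r' y) := by
        simp [expLoss, mul_sub]
    _ ≤ ∑ y, p y * lossRange ℓ :=
        Finset.sum_le_sum fun y _ => mul_le_mul_of_nonneg_left (h y) (hp.1 y)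
    _ = lossRange ℓ := by rw [← Finset.sum_mul, hp.2, one_mul]

omit [Fintype R] in
theorem epsLink_le_infDist {p : Y → ℝ} (hp : p ∈ stdSimplex ℝ Y) {u : Fin d → ℝ}
    (hu : ψ u ∉ prop ℓ p) : epsLink L ψ ℓ ≤ ENNReal.ofReal (Metric.infDist u (prop L p)) :=
  iSup₂_le fun ε hε => by
    rw [← ENNReal.ofReal_coe_nnreal]
    exact ENNReal.ofReal_le_ofReal (hε p hp u hu).le

omit [Fintype R] in
theorem le_epsLink {ε : ℝ≥0} (hε : Separated L ψ ℓ ε) : (ε : ℝ≥0∞) ≤ epsLink L ψ ℓ :=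
  le_iSup₂ (f := fun (ε : ℝ≥0) (_ : Separated L ψ ℓ ε) => (ε : ℝ≥0∞)) ε hε

/-- The regret bound at the vertices of the full-dimensional level sets. -/
theorem expLoss_sub_le_of_mem_levelVertices (hL : PolyhedralLoss L) {ε : ℝ≥0} (hε0 : 0 < ε)
    (hε : Separated L ψ ℓ ε) {p : Y → ℝ} (hv : p ∈ levelVertices L) (u : Fin d → ℝ) (r : R) :
    expLoss ℓ p (ψ u) - expLoss ℓ p r ≤ transferConst L ψ ℓ * condRegret L u p := by
  have hp : p ∈ stdSimplex ℝ Y := by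
    obtain ⟨u, -, hu⟩ := hv
    exact hu.1.1
  have hc := condRegret_nonneg L hp u
  by_cases hu : ψ u ∈ prop ℓ p
  · have := hu r
    have : 0 ≤ transferConst L ψ ℓ * condRegret L u p := by positivity
    linarith
  -- A link error bounds `ε_ψ` by a distance, so the `[0,∞]` quotient is here a quotient of reals.
  have htop : epsLink L ψ ℓ ≠ ⊤ := ne_top_of_le_ne_top ENNReal.ofReal_ne_top (epsLink_le_infDist hp hu)
  have hpos : 0 < (epsLink L ψ ℓ).toReal :=
    ENNReal.toReal_pos (((ENNReal.coe_pos.2 hε0).trans_le (le_epsLink hε)).ne') htop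
  have h1 : (epsLink L ψ ℓ).toReal ≤ hoffman L * condRegret L u p := by
    refine (ENNReal.toReal_le_of_le_ofReal Metric.infDist_nonneg
      (epsLink_le_infDist hp hu)).trans ((hL.infDist_le_hoffmanAt_mul hp u).trans ?_)
    exact mul_le_mul_of_nonneg_right (NNReal.coe_le_coe.2 (hL.hoffmanAt_le_hoffman hv)) hc
  have h2 : (transferConst L ψ ℓ : ℝ) = lossRange ℓ * hoffman L / (epsLink L ψ ℓ).toReal := by
    change (_ : ℝ≥0∞).toReal = _
    simp [ENNReal.toReal_div, ENNReal.toReal_mul]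
  refine (expLoss_sub_le_lossRange hp _ _).trans ?_
  rw [h2, div_mul_eq_mul_div, le_div_iff₀ hpos, mul_assoc]
  exact mul_le_mul_of_nonneg_left h1 (lossRange ℓ).2

/-- The conditional regret bound, obtained from the vertices by convexity. -/
theorem expLoss_sub_le_transferConst_mul (hL : PolyhedralLoss L) {ε : ℝ≥0} (hε0 : 0 < ε)
    (hε : Separated L ψ ℓ ε) {p : Y → ℝ} (hp : p ∈ stdSimplex ℝ Y) (u v : Fin d → ℝ)
    (hv : v ∈ prop L p) (r : R) :
    expLoss ℓ p (ψ u) + transferConst L ψ ℓ * expLoss L p v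
      ≤ transferConst L ψ ℓ * expLoss L p u + expLoss ℓ p r := by
  obtain ⟨w, hw, hpw⟩ := hL.exists_fullDim_levelSet hp
  -- With `w` fixed, the Bayes risk on its level set is `expLoss L q w`, so the inequality is linear
  -- in `q` and passes from the extreme points to the whole level set.
  have key : levelSet L w ⊆ {q | expLoss ℓ q (ψ u) + transferConst L ψ ℓ * expLoss L q w
      ≤ transferConst L ψ ℓ * expLoss L q u + expLoss ℓ q r} := by
    refine levelSet_subset_of_extremePoints_subset ?_ ?_ ?_
    · exact isClosed_le
        ((continuous_expLoss ℓ _).add (continuous_const.mul (continuous_expLoss L _)))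
        ((continuous_const.mul (continuous_expLoss L _)).add (continuous_expLoss ℓ _))
    · intro q hq q' hq' a b ha hb hab
      have h1 := mul_le_mul_of_nonneg_left hq ha
      have h2 := mul_le_mul_of_nonneg_left hq' hb
      simp only [Set.mem_ofPred_eq, expLoss_add, expLoss_smul]
      linarith
    · intro q hq
      have h1 := expLoss_sub_le_of_mem_levelVertices hL hε0 hε ⟨w, hw, hq⟩ u r
      rw [condRegret, bayesRisk_eq_of_mem_prop hq.1.1 hq.1.2, mul_sub] at h1
      simp only [Set.mem_ofPred_eq]
      linarith
  have h1 := key hpw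
  have h2 : expLoss L p v = expLoss L p w := le_antisymm (hv w) (hpw.2 v)
  rw [h2]
  exact h1

end CondBound

/-! ### Lipschitz continuity and measurability of the surrogate -/

section Lipschitz

variable {Y : Type*} {d : ℕ} {L : (Fin d → ℝ) → Y → ℝ≥0}

theorem PolyhedralLoss.exists_lipschitz [Fintype Y] (hL : PolyhedralLoss L) :
    ∃ K : ℝ≥0, ∀ y u v, (L u y : ℝ) ≤ L v y + K * dist u v := by
  obtain ⟨s, hle, hex⟩ := hL.exists_pieces
  refine ⟨∑ y, ∑ g ∈ s y, ‖LinearMap.toContinuousLinearMap g.linear‖₊, fun y u v => ?_⟩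
  obtain ⟨g, hg, e⟩ := hex y u
  have h1 : g u = g.linear (u - v) + g v := by
    have := g.map_vadd v (u - v)
    simpa using this
  have h2 : g.linear (u - v) ≤ ‖LinearMap.toContinuousLinearMap g.linear‖₊ * dist u v := by
    rw [dist_eq_norm]
    exact (le_abs_self _).trans ((LinearMap.toContinuousLinearMap g.linear).le_opNorm (u - v))
  have h3 : ‖LinearMap.toContinuousLinearMap g.linear‖₊
      ≤ ∑ y, ∑ g ∈ s y, ‖LinearMap.toContinuousLinearMap g.linear‖₊ :=
    (Finset.single_le_sum
      (f := fun g : (Fin d → ℝ) →ᵃ[ℝ] ℝ => ‖LinearMap.toContinuousLinearMap g.linear‖₊)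
      (fun _ _ => zero_le) hg).trans
    (Finset.single_le_sum
      (f := fun y => ∑ g ∈ s y, ‖LinearMap.toContinuousLinearMap g.linear‖₊)
      (fun _ _ => zero_le) (Finset.mem_univ y))
  have h4 := mul_le_mul_of_nonneg_right (NNReal.coe_le_coe.2 h3) (dist_nonneg (x := u) (y := v))
  have h5 := hle y v g hg
  linarith

theorem PolyhedralLoss.measurable [Fintype Y] (hL : PolyhedralLoss L) (y : Y) :
    Measurable fun u => L u y := by
  obtain ⟨K, hK⟩ := hL.exists_lipschitz
  have h : LipschitzWith K fun u => (L u y : ℝ) := LipschitzWith.of_le_add_mul K (hK y)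
  simpa using h.continuous.measurable.real_toNNReal

theorem expLoss_le_add_mul_dist [Fintype Y] {K : ℝ≥0}
    (hK : ∀ y u v, (L u y : ℝ) ≤ L v y + K * dist u v) {p : Y → ℝ} (hp : p ∈ stdSimplex ℝ Y)
    (u v : Fin d → ℝ) : expLoss L p u ≤ expLoss L p v + K * dist u v := by
  calc expLoss L p u ≤ ∑ y, p y * (L v y + K * dist u v) :=
        Finset.sum_le_sum fun y _ => mul_le_mul_of_nonneg_left (hK y u v) (hp.1 y)
    _ = expLoss L p v + K * dist u v := by
        simp only [mul_add, Finset.sum_add_distrib, ← Finset.sum_mul, hp.2, one_mul, expLoss]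

end Lipschitz

/-! ### Risk as an integral of conditional expected losses -/

section Risk

variable {X R Y : Type*} [MeasurableSpace X] [Fintype Y] [MeasurableSpace Y]
  [MeasurableSingletonClass Y]

theorem measureReal_singleton_mem_stdSimplex (P : Measure Y) [IsProbabilityMeasure P] :
    (fun y => P.real {y}) ∈ stdSimplex ℝ Y :=
  ⟨fun _ => measureReal_nonneg, by
    rw [sum_measureReal_singleton, Finset.coe_univ, probReal_univ]⟩

theorem lintegral_eq_ofReal_expLoss (f : R → Y → ℝ≥0) (r : R) (P : Measure Y)
    [IsProbabilityMeasure P] :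
    ∫⁻ y, (f r y : ℝ≥0∞) ∂P = ENNReal.ofReal (expLoss f (fun y => P.real {y}) r) := by
  rw [lintegral_fintype, expLoss, ENNReal.ofReal_sum_of_nonneg fun y _ =>
    mul_nonneg measureReal_nonneg (f r y).coe_nonneg]
  refine Finset.sum_congr rfl fun y _ => ?_
  rw [ENNReal.ofReal_mul measureReal_nonneg, ofReal_measureReal, ENNReal.ofReal_coe_nnreal,
    mul_comm]

theorem exists_isProbabilityMeasure_real_eq {p : Y → ℝ} (hp : p ∈ stdSimplex ℝ Y) :
    ∃ P : Measure Y, IsProbabilityMeasure P ∧ (fun y => P.real {y}) = p := by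
  have hs : ∑ y, ENNReal.ofReal (p y) = 1 := by
    rw [← ENNReal.ofReal_sum_of_nonneg fun y _ => hp.1 y, hp.2, ENNReal.ofReal_one]
  refine ⟨(PMF.ofFintype _ hs).toMeasure, inferInstance, ?_⟩
  ext y
  rw [Measure.real, PMF.toMeasure_apply_singleton _ _ (measurableSet_singleton y),
    PMF.ofFintype_apply, ENNReal.toReal_ofReal (hp.1 y)]

theorem measurable_loss_comp [MeasurableSpace R] {f : R → Y → ℝ≥0}
    (hf : ∀ y, Measurable fun r => f r y) {g : X → R} (hg : Measurable g) :
    Measurable fun z : X × Y => (f (g z.1) z.2 : ℝ≥0∞) :=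
  (measurable_from_prod_countable_left fun y => (hf y).comp hg).coe_nnreal_ennreal

/-- When the marginal on `X` sits at `x`, a hypothesis matters only through its value at `x`, and a
constant one attains the infimum. -/
theorem regret_map_prodMk [MeasurableSpace R] {f : R → Y → ℝ≥0}
    (hf : ∀ y, Measurable fun r => f r y) {p : Y → ℝ} (hne : (prop f p).Nonempty)
    (P : Measure Y) [IsProbabilityMeasure P] (hP : (fun y => P.real {y}) = p)
    (x : X) {g : X → R} (hg : Measurable g) :
    regret f g (P.map fun y => (x, y)) = ENNReal.ofReal (condRegret f (g x) p) := by
  have hp : p ∈ stdSimplex ℝ Y := hP ▸ measureReal_singleton_mem_stdSimplex P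
  have hr : ∀ g : X → R, Measurable g →
      risk f g (P.map fun y => (x, y)) = ENNReal.ofReal (expLoss f p (g x)) := fun g hg => by
    rw [risk, lintegral_map (measurable_loss_comp hf hg) measurable_prodMk_left,
      lintegral_eq_ofReal_expLoss f (g x) P, hP]
  obtain ⟨r, hrp⟩ := hne
  have hinf : ⨅ (g' : X → R) (_ : Measurable g'), risk f g' (P.map fun y => (x, y))
      = ENNReal.ofReal (bayesRisk f p) := by
    refine le_antisymm (iInf₂_le_of_le (fun _ => r) measurable_const ?_)
      (le_iInf₂ fun g' hg' => ?_)
    · rw [hr _ measurable_const, bayesRisk_eq_of_mem_prop hp hrp]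
    · rw [hr _ hg']
      exact ENNReal.ofReal_le_ofReal (bayesRisk_le f hp _)
  rw [regret, hinf, hr g hg, condRegret, ENNReal.ofReal_sub]
  rw [bayesRisk_eq_of_mem_prop hp hrp]
  exact expLoss_nonneg f hp r

theorem risk_eq_lintegral_ofReal_expLoss [Nonempty Y] [MeasurableSpace R] {f : R → Y → ℝ≥0}
    (hf : ∀ y, Measurable fun r => f r y) (D : Measure (X × Y)) [IsFiniteMeasure D]
    {g : X → R} (hg : Measurable g) :
    risk f g D = ∫⁻ x, ENNReal.ofReal
      (expLoss f (fun y => (D.condKernel x).real {y}) (g x)) ∂D.fst := by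
  rw [risk]
  -- Only the finite factor `Y` has to be standard Borel, so `X` can be an arbitrary measurable
  -- space.
  nth_rw 1 [← D.disintegrate D.condKernel]
  rw [Measure.lintegral_compProd (measurable_loss_comp hf hg)]
  exact lintegral_congr fun x => lintegral_eq_ofReal_expLoss f (g x) _

end Risk

/-! ### From conditional bounds to guarantees, and back -/

section Guarantees

variable {X R Y : Type*} [MeasurableSpace X] [Fintype R] [MeasurableSpace R]
  [MeasurableSingletonClass R] [Fintype Y] [MeasurableSpace Y] [MeasurableSingletonClass Y]
  {d : ℕ} {L : (Fin d → ℝ) → Y → ℝ≥0} {ψ : (Fin d → ℝ) → R} {ℓ : R → Y → ℝ≥0}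

-- The first optimal element in an enumeration of a finite representative set `T` is a measurable
-- choice, because optimality need only be tested against `T`. Its values lying in `T` makes the
-- risk of the selection finite.
omit [MeasurableSpace Y] [MeasurableSingletonClass Y] in
theorem PolyhedralLoss.exists_measurable_selection (hL : PolyhedralLoss L) {q : X → Y → ℝ}
    (hq : ∀ y, Measurable fun x => q x y) (hqS : ∀ x, q x ∈ stdSimplex ℝ Y) :
    ∃ (g : X → Fin d → ℝ) (T : Finset (Fin d → ℝ)), Measurable g ∧
      ∀ x, g x ∈ prop L (q x) ∧ g x ∈ T := by
  classical
  obtain ⟨T, hT⟩ := hL.exists_finite_representative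
  rcases isEmpty_or_nonempty X with hX | ⟨⟨x₀⟩⟩
  · exact ⟨fun _ => 0, T, measurable_const, fun x => hX.elim x⟩
  obtain ⟨t₀, ht₀, -⟩ := hT _ (hqS x₀)
  have : Nonempty T := ⟨⟨t₀, ht₀⟩⟩
  obtain ⟨e, he⟩ := exists_surjective_nat T
  have hm : ∀ n, MeasurableSet {x | ∀ t ∈ T, expLoss L (q x) (e n) ≤ expLoss L (q x) t} := by
    intro n
    simp only [Set.ofPred_forall]
    have hml : ∀ u, Measurable fun x => expLoss L (q x) u := fun u => by
      unfold expLoss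
      fun_prop
    exact Finset.measurableSet_biInter T fun t _ => measurableSet_le (hml _) (hml _)
  have hex : ∀ x, ∃ n, ∀ t ∈ T, expLoss L (q x) (e n) ≤ expLoss L (q x) t := by
    intro x
    obtain ⟨u, hu, hup⟩ := hT _ (hqS x)
    obtain ⟨n, hn⟩ := he ⟨u, hu⟩
    exact ⟨n, fun t _ => by rw [hn]; exact hup t⟩
  refine ⟨fun x => e (Nat.find (hex x)), T,
    Measurable.find (f := fun n _ => (e n : Fin d → ℝ)) (fun n => measurable_const) hm hex,
    fun x => ⟨fun v => ?_, (e _).2⟩⟩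
  obtain ⟨u, hu, hup⟩ := hT _ (hqS x)
  exact (Nat.find_spec (hex x) u hu).trans (hup v)

theorem Separated.guarantees (hL : PolyhedralLoss L) {ε : ℝ≥0} (hε0 : 0 < ε)
    (hε : Separated L ψ ℓ ε) : Guarantees X L ψ ℓ (fun t => transferConst L ψ ℓ * t) := by
  intro D hD h hh hψh hfin
  have : Nonempty Y := by
    obtain ⟨z⟩ := D.nonempty_of_neZero
    exact ⟨z.2⟩
  set c := transferConst L ψ ℓ with hc
  have hℓm : ∀ y, Measurable fun r => ℓ r y := fun y => measurable_of_finite _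
  set q : X → Y → ℝ := fun x y => (D.condKernel x).real {y} with hq
  have hqS : ∀ x, q x ∈ stdSimplex ℝ Y := fun x => measureReal_singleton_mem_stdSimplex _
  have hqm : ∀ y, Measurable fun x => q x y := fun y =>
    (D.condKernel.measurable_coe (measurableSet_singleton y)).ennreal_toReal
  obtain ⟨g, T, hgm, hg⟩ := hL.exists_measurable_selection hqm hqS
  have hrL : ∀ g : X → Fin d → ℝ, Measurable g →
      risk L g D = ∫⁻ x, ENNReal.ofReal (expLoss L (q x) (g x)) ∂D.fst := fun g hg =>
    risk_eq_lintegral_ofReal_expLoss hL.measurable D hg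
  have hrℓ : ∀ g : X → R, Measurable g →
      risk ℓ g D = ∫⁻ x, ENNReal.ofReal (expLoss ℓ (q x) (g x)) ∂D.fst := fun g hg =>
    risk_eq_lintegral_ofReal_expLoss hℓm D hg
  have hmeas : ∀ g : X → Fin d → ℝ, Measurable g →
      Measurable fun x => ENNReal.ofReal (expLoss L (q x) (g x)) := fun g hg => by
    refine ENNReal.measurable_ofReal.comp ?_
    unfold expLoss
    exact Finset.measurable_sum _ fun y _ =>
      (hqm y).mul ((hL.measurable y).comp hg).coe_nnreal_real
  have hgfin : risk L g D ≠ ⊤ := by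
    have hb : ∀ z : X × Y, (L (g z.1) z.2 : ℝ≥0∞) ≤ ((∑ t ∈ T, ∑ y, L t y : ℝ≥0) : ℝ≥0∞) := by
      intro z
      refine ENNReal.coe_le_coe.2 ?_
      exact (Finset.single_le_sum (f := fun y => L (g z.1) y) (fun _ _ => zero_le)
        (Finset.mem_univ z.2)).trans
        (Finset.single_le_sum (f := fun t => ∑ y, L t y) (fun _ _ => zero_le) (hg z.1).2)
    refine ne_top_of_le_ne_top ?_ (lintegral_mono hb)
    simp
  -- The additive form avoids subtracting risks, as that of `h` is not yet known to be finite.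
  have hkey : ∀ g' : X → R, Measurable g' →
      risk ℓ (ψ ∘ h) D + c * risk L g D ≤ c * risk L h D + risk ℓ g' D := by
    intro g' hg'
    rw [hrℓ _ hψh, hrℓ _ hg', hrL _ hgm, hrL _ hh, ← lintegral_const_mul _ (hmeas g hgm),
      ← lintegral_const_mul _ (hmeas h hh), ← lintegral_add_right _ ((hmeas g hgm).const_mul _),
      ← lintegral_add_left ((hmeas h hh).const_mul _)]
    refine lintegral_mono fun x => ?_
    have hcr : (c : ℝ≥0∞) = ENNReal.ofReal c := (ENNReal.ofReal_coe_nnreal).symm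
    have e1 := expLoss_nonneg ℓ (hqS x)
    have e2 := expLoss_nonneg L (hqS x)
    rw [hcr, ← ENNReal.ofReal_mul c.coe_nonneg, ← ENNReal.ofReal_mul c.coe_nonneg,
      ← ENNReal.ofReal_add (e1 _) (mul_nonneg c.coe_nonneg (e2 _)),
      ← ENNReal.ofReal_add (mul_nonneg c.coe_nonneg (e2 _)) (e1 _)]
    exact ENNReal.ofReal_le_ofReal
      (expLoss_sub_le_transferConst_mul hL hε0 hε (hqS x) (h x) (g x) (hg x).1 (g' x))
  have hkey' : risk ℓ (ψ ∘ h) D + c * risk L g D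
      ≤ c * risk L h D + ⨅ (g' : X → R) (_ : Measurable g'), risk ℓ g' D := by
    simp only [ENNReal.add_iInf]
    exact le_iInf₂ hkey
  have hfinal : regret ℓ (ψ ∘ h) D ≤ c * (risk L h D - risk L g D) := by
    rw [ENNReal.mul_sub fun _ _ => ENNReal.coe_ne_top]
    have hcg : (c : ℝ≥0∞) * risk L g D ≠ ⊤ := ENNReal.mul_ne_top ENNReal.coe_ne_top hgfin
    rw [regret, tsub_le_iff_right]
    refine (ENNReal.le_sub_of_add_le_right hcg hkey').trans ?_
    rw [tsub_le_iff_right, add_right_comm]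
    exact add_le_add_left le_tsub_add _
  refine hfinal.trans ?_
  rw [ENNReal.coe_mul, ENNReal.coe_toNNReal hfin]
  -- The easy direction suffices: the risk of `g` is at least the infimum, so optimality of `g` over
  -- all hypotheses need not be shown.
  have hle : risk L h D - risk L g D ≤ regret L h D :=
    tsub_le_tsub_left (iInf₂_le (f := fun (g' : X → Fin d → ℝ) (_ : Measurable g') => risk L g' D)
      g hgm) _
  gcongr

omit [Fintype R] [MeasurableSingletonClass R] [Fintype Y] [MeasurableSingletonClass Y] in
theorem LinearTransfer.consistent (h : LinearTransfer X L ψ ℓ) : Consistent X L ψ ℓ := by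
  obtain ⟨α, hα⟩ := h
  exact ⟨_, ⟨mul_zero α, by fun_prop⟩, hα⟩

/-- The guarantee is tested on a constant hypothesis and a distribution concentrated over a single
point of `X`. -/
theorem Guarantees.condRegret_le [Nonempty X] (hL : PolyhedralLoss L) {ζ : ℝ≥0 → ℝ≥0}
    (h : Guarantees X L ψ ℓ ζ) {p : Y → ℝ} (hp : p ∈ stdSimplex ℝ Y) (u : Fin d → ℝ) :
    condRegret ℓ (ψ u) p ≤ ζ (condRegret L u p).toNNReal := by
  obtain ⟨P, hP, hPp⟩ := exists_isProbabilityMeasure_real_eq hp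
  obtain ⟨x⟩ := ‹Nonempty X›
  have hℓ : (prop ℓ p).Nonempty := by
    have : Nonempty R := ⟨ψ 0⟩
    exact Finite.exists_min (expLoss ℓ p)
  have h1 := regret_map_prodMk hL.measurable (hL.prop_nonempty hp) P hPp x
    (g := fun _ => u) measurable_const
  have h2 := regret_map_prodMk (f := ℓ) (fun y => measurable_of_finite _) hℓ P hPp x
    (g := ψ ∘ fun _ => u) measurable_const
  have h3 := h (P.map fun y => (x, y))
    (Measure.isProbabilityMeasure_map measurable_prodMk_left.aemeasurable) (fun _ => u)
    measurable_const measurable_const (by rw [h1]; exact ENNReal.ofReal_ne_top)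
  rw [h1, h2] at h3
  exact (ENNReal.ofReal_le_ofReal_iff (NNReal.coe_nonneg _)).1
    (by rw [ENNReal.ofReal_coe_nnreal]; exact h3)

theorem Consistent.exists_separated [Nonempty X] (hL : PolyhedralLoss L)
    (h : Consistent X L ψ ℓ) : ∃ ε : ℝ≥0, 0 < ε ∧ Separated L ψ ℓ ε := by
  obtain ⟨ζ, ⟨hζ0, hζc⟩, hζ⟩ := h
  obtain ⟨K, hK⟩ := hL.exists_lipschitz
  set V := ⋃ u, (levelSet L u).extremePoints ℝ with hV
  have hVfin : V.Finite := hL.finite_iUnion_extremePoints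
  have hVS : ∀ q ∈ V, q ∈ stdSimplex ℝ Y := fun q hq => by
    obtain ⟨u, hu⟩ := Set.mem_iUnion.1 hq
    exact hu.1.1
  -- a positive lower bound for the nonzero target regrets at the vertices
  obtain ⟨c, hc0, hc⟩ : ∃ c : ℝ, 0 < c ∧ ∀ q ∈ V, ∀ r, r ∉ prop ℓ q → c ≤ condRegret ℓ r q := by
    have hW : {z : (Y → ℝ) × R | z.1 ∈ V ∧ z.2 ∉ prop ℓ z.1}.Finite :=
      (hVfin.prod Set.finite_univ).subset fun z hz => ⟨hz.1, Set.mem_univ _⟩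
    rcases Set.eq_empty_or_nonempty {z : (Y → ℝ) × R | z.1 ∈ V ∧ z.2 ∉ prop ℓ z.1} with he | hne
    · refine ⟨1, one_pos, fun q hq r hr => ?_⟩
      have : (q, r) ∈ {z : (Y → ℝ) × R | z.1 ∈ V ∧ z.2 ∉ prop ℓ z.1} := ⟨hq, hr⟩
      rw [he] at this
      exact this.elim
    · obtain ⟨z, hz, hmin⟩ := Set.exists_min_image _ (fun z => condRegret ℓ z.2 z.1) hW hne
      exact ⟨_, condRegret_pos (hVS _ hz.1) hz.2, fun q hq r hr => hmin (q, r) ⟨hq, hr⟩⟩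
  obtain ⟨δ, hδ0, hδ⟩ : ∃ δ : ℝ, 0 < δ ∧ ∀ t : ℝ≥0, (t : ℝ) < δ → (ζ t : ℝ) < c := by
    obtain ⟨δ, hδ0, hδ⟩ := Metric.continuousAt_iff.1 hζc c hc0
    refine ⟨δ, hδ0, fun t ht => ?_⟩
    have := hδ (x := t) (by simpa [NNReal.dist_eq] using ht)
    simpa [NNReal.dist_eq, hζ0] using this
  -- The factor `2` turns a failure of separation into a strict inequality, so that an actual `v ∈
  -- Γ(p)` with `K * dist u v < δ` can be chosen.
  refine ⟨⟨δ / (2 * (K + 1)), by positivity⟩, ?_, fun p hp u hu => ?_⟩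
  · change (0 : ℝ) < δ / (2 * (K + 1))
    positivity
  by_contra hlt
  have hlt : Metric.infDist u (prop L p) < δ / (K + 1) := by
    refine (not_lt.1 hlt).trans_lt ?_
    change δ / (2 * (K + 1)) < _
    exact div_lt_div_of_pos_left hδ0 (by positivity) (by nlinarith [K.2])
  obtain ⟨v, hv, hd⟩ := (Metric.infDist_lt_iff (hL.prop_nonempty hp)).1 hlt
  -- Passing from `p` to a vertex is essential: the regret of `ψ u` at `p` itself may be arbitrarily
  -- small, while at vertices it is at least `c`.
  obtain ⟨q, hq, hqu⟩ : ∃ q ∈ (levelSet L v).extremePoints ℝ, ψ u ∉ prop ℓ q := by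
    by_contra! hall
    have := levelSet_subset_of_extremePoints_subset (isClosed_levelSet ℓ (ψ u))
      (convex_levelSet ℓ (ψ u)) (fun q hq => ⟨hq.1.1, hall q hq⟩) (⟨hp, hv⟩ : p ∈ levelSet L v)
    exact hu this.2
  have h1 : condRegret L u q < δ := by
    rw [condRegret, bayesRisk_eq_of_mem_prop hq.1.1 hq.1.2]
    have h2 := expLoss_le_add_mul_dist hK hq.1.1 u v
    rw [lt_div_iff₀ (by positivity)] at hd
    nlinarith [dist_nonneg (x := u) (y := v)]
  have h2 := hc q (Set.mem_iUnion.2 ⟨v, hq⟩) _ hqu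
  have h3 := hζ.condRegret_le hL hq.1.1 u
  have h4 := hδ (condRegret L u q).toNNReal
    (by rwa [Real.coe_toNNReal _ (condRegret_nonneg L hq.1.1 u)])
  linarith

end Guarantees

end SurrogateRegret

/-! ### The equivalence and the explicit constant -/

theorem mainTheorem4 {X R Y : Type*} [MeasurableSpace X] [Nonempty X]
    [Fintype R] [MeasurableSpace R] [MeasurableSingletonClass R]
    [Fintype Y] [MeasurableSpace Y] [MeasurableSingletonClass Y] {d : ℕ}
    (ℓ : R → Y → ℝ≥0) (hℓ : SurrogateRegret.NonRedundant ℓ)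
    (L : (Fin d → ℝ) → Y → ℝ≥0) (hL : SurrogateRegret.PolyhedralLoss L)
    (ψ : (Fin d → ℝ) → R) :
    List.TFAE [
      SurrogateRegret.Consistent X L ψ ℓ,
      ∃ ε : ℝ≥0, 0 < ε ∧ SurrogateRegret.Separated L ψ ℓ ε,
      SurrogateRegret.LinearTransfer X L ψ ℓ] ∧
    ((SurrogateRegret.Consistent X L ψ ℓ ∨
      (∃ ε : ℝ≥0, 0 < ε ∧ SurrogateRegret.Separated L ψ ℓ ε) ∨
      SurrogateRegret.LinearTransfer X L ψ ℓ) →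
      SurrogateRegret.Guarantees X L ψ ℓ
        (fun t => SurrogateRegret.transferConst L ψ ℓ * t)) := by
  have h12 : SurrogateRegret.Consistent X L ψ ℓ →
      ∃ ε : ℝ≥0, 0 < ε ∧ SurrogateRegret.Separated L ψ ℓ ε := fun h => h.exists_separated hL
  have h2 : (∃ ε : ℝ≥0, 0 < ε ∧ SurrogateRegret.Separated L ψ ℓ ε) →
      SurrogateRegret.Guarantees X L ψ ℓ
        (fun t => SurrogateRegret.transferConst L ψ ℓ * t) := fun ⟨_, hε0, hε⟩ =>
    hε.guarantees hL hε0
  have h31 : SurrogateRegret.LinearTransfer X L ψ ℓ → SurrogateRegret.Consistent X L ψ ℓ :=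
    fun h => h.consistent
  refine ⟨?_, ?_⟩
  · tfae_have 1 → 2 := h12
    tfae_have 2 → 3 := fun h => ⟨_, h2 h⟩
    tfae_have 3 → 1 := h31
    tfae_finish
  · rintro (h | h | h)
    · exact h2 (h12 h)
    · exact h2 h
    · exact h2 (h12 (h31 h))
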